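/- Let $m\ge 1$, $\mathcal M=\{1,\dots,m\}$, and let $Y=(Y_t)_{t\ge 0}$ be a right-continuous continuous-time Markov chain on a probability space $(\Omega,\mathcal F,\mathbb P)$ with state space $\mathcal M$ and generator $Q=(q_{ij})$, where $q_{ij}\ge 0$ for $i\ne j$, $\sum_j q_{ij}=0$ and $q_i:=-q_{ii}>0$. (That is, given the history of $Y$ up to time $s\le t$, the probability that $Y_t=j$ is $(e^{(t-s)Q})_{Y_s j}$.) Let $\delta(1),\dots,\delta(m)\in\mathbb R$ be arbitrary and, for $i$ with $\mathbb P(Y_0=i)>0$, put $$g(i,\tau)=\mathbb E\Big[\exp\Big(-\int_0^\tau\delta(Y_u)\,du\Big)\,\Big|\,Y_0=i\Big],\qquad \tau\ge 0,\qquad \mathcal L\{g(i,\cdot)\}(u)=\int_0^\infty g(i,t)e^{-ut}\,dt .$$ **Theorem.** There is a monic polynomial $D(u)=u^m+\beta_{m-1}u^{m-1}+\cdots+\beta_0$ with real coefficients, equal for all $u\in\mathbb C$ to the determinant of the $m\times m$ matrix with diagonal entries $u+\delta(i)+q_i$ and off-diagonal entries $-q_{ij}$, such that for each $i$ with $\mathbb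 P(Y_0=i)>0$ the following hold. 1. The function $g(i,\cdot)$ is continuous on $[0,\infty)$ and of exponential order, i.e. $|g(i,t)|\le Ke^{pt}$ for some $K>0$, $p\ge 0$. If $\operatorname{Re}u>-\delta(j)$ for all $j$, then the Laplace integral of $g(i,\cdot)$ converges absolutely at $u$ and $D(u)\ne 0$. 2. There is a monic polynomial $N_i(u)=u^{m-1}+\alpha_{i,m-2}u^{m-2}+\cdots+\alpha_{i,0}$ with real coefficients such that $$\mathcal L\{g(i,\cdot)\}(u)=\frac{N_i(u)}{D(u)}=\frac{u^{m-1}+\alpha_{i,m-2}u^{m-2}+\cdots+\alpha_{i,0}}{u^m+\beta_{m-1}u^{m-1}+\cdots+\beta_0}$$ for every $u\in\mathbb C$ with $D(u)\ne 0$ at which the Laplace integral converges absolutely. 3. Let $z_1,\dots,z_r$ be the distinct complex roots of $D$, with multiplicities $n_1,\dots,n_r$. Then there are complex numbers $c_{\ell,k}$ (depending on $i$) with $$\frac{N_i(u)}{D(u)}=\sum_{\ell=1}^{r}\sum_{k=0}^{n_\ell-1}\frac{c_{\ell,k}}{(u-z_\ell)^{k+1}}\quad (D(u)\neq 0),\qquad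 g(i,t)=\sum_{\ell=1}^{r}\sum_{k=0}^{n_\ell-1}c_{\ell,k}\,\frac{t^{k}}{k!}\,e^{z_\ell t}\quad (t\ge 0).$$ -/

import Mathlib

open MeasureTheory ProbabilityTheory
open scoped NNReal

namespace RegimeSwitching

/-- The rate `q_i = -q_{ii}` of leaving regime `i`. -/
def exitRate {m : ℕ} (Q : Matrix (Fin m) (Fin m) ℝ) (i : Fin m) : ℝ := -Q i i

/-- `Q` is a generator (a conservative rate matrix) without absorbing regimes. -/
structure IsGenerator {m : ℕ} (Q : Matrix (Fin m) (Fin m) ℝ) : Prop where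
  offDiag_nonneg : ∀ i j, i ≠ j → 0 ≤ Q i j
  row_sum : ∀ i, ∑ j, Q i j = 0
  exitRate_pos : ∀ i, 0 < exitRate Q i

/-- The history `σ(Y_u : u ≤ s)` of a process with values in the finite discrete set `Fin m`. -/
abbrev history {Ω : Type*} {m : ℕ} (Y : ℝ≥0 → Ω → Fin m) (s : ℝ≥0) : MeasurableSpace Ω :=
  ⨆ u : Set.Iic s, MeasurableSpace.comap (Y u) ⊤

/-- `Y` is a continuous-time Markov chain with generator `Q` under the probability measure `P`: its paths are almost
surely right-continuous (for the discrete topology) and, given its history up to time `s`, the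
probability that `Y_t = j` is the entry at `(Y_s, j)` of the transition matrix `e^{(t-s)Q}`.
The initial law is arbitrary. -/
structure IsMarkovChain {Ω : Type*} [MeasurableSpace Ω] {m : ℕ} (P : Measure Ω)
    (Q : Matrix (Fin m) (Fin m) ℝ) (Y : ℝ≥0 → Ω → Fin m) : Prop where
  measurable : ∀ t, Measurable (Y t)
  rightContinuous : ∀ᵐ ω ∂P, ∀ t, ContinuousWithinAt (fun s => Y s ω) (Set.Ici t) t
  markov : ∀ s t : ℝ≥0, s ≤ t → ∀ j : Fin m,
    P[(Y t ⁻¹' {j}).indicator (fun _ => (1 : ℝ)) | history Y s] =ᵐ[P]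
      fun ω => NormedSpace.exp (((t : ℝ) - (s : ℝ)) • Q) (Y s ω) j

/-- `g(i, τ) = 𝔼[exp(-∫₀^τ δ(Y_u) du) | Y₀ = i]`. -/
noncomputable def g {Ω : Type*} [MeasurableSpace Ω] {m : ℕ} (P : Measure Ω)
    (Y : ℝ≥0 → Ω → Fin m) (δ : Fin m → ℝ) (i : Fin m) (τ : ℝ) : ℝ :=
  ∫ ω, Real.exp (-∫ u in (0 : ℝ)..τ, δ (Y u.toNNReal ω)) ∂(ProbabilityTheory.cond P (Y 0 ⁻¹' {i}))

/-- The integrand `F(t) e^{-ut}` of the Laplace transform of `F` at `u`. -/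
noncomputable def laplaceIntegrand (F : ℝ → ℝ) (u : ℂ) (t : ℝ) : ℂ :=
  (F t : ℂ) * Complex.exp (-u * (t : ℂ))

/-- The Laplace integral of `F` converges absolutely at `u`. -/
def LaplaceConverges (F : ℝ → ℝ) (u : ℂ) : Prop :=
  IntegrableOn (laplaceIntegrand F u) (Set.Ioi 0)

/-- The Laplace transform `∫₀^∞ F(t) e^{-ut} dt`. -/
noncomputable def laplaceTransform (F : ℝ → ℝ) (u : ℂ) : ℂ :=
  ∫ t in Set.Ioi (0 : ℝ), laplaceIntegrand F u t

/-- The `m × m` matrix with diagonal entries `u + δ(i) + q_i` and off-diagonal entries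
`-q_{ij}`. -/
def systemMatrix {m : ℕ} (Q : Matrix (Fin m) (Fin m) ℝ) (δ : Fin m → ℝ) (u : ℂ) :
    Matrix (Fin m) (Fin m) ℂ :=
  Matrix.of fun i j => if i = j then u + (δ i : ℂ) + (exitRate Q i : ℂ) else -(Q i j : ℂ)

end RegimeSwitching

/-! Put A = Q - diag δ. Everything rests on the Feynman-Kac formula g(i,t) = (e^{tA} 1)_i,
`IsMarkovChain.g_eq_exp`. Along a grid of mesh h the Markov property turns the expected discount
factor into powers of e^{hQ} e^{-h diag δ}. As the mesh shrinks, right-continuity of the paths and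
dominated convergence give g on one side, and the Lie-Trotter formula gives e^{tA} on the other.

The Laplace transform of e^{tA} 1 is then the resolvent vector w solving (u - A) w = 1. By Cramer's
rule w_i = N_i(u)/D(u), where D is the characteristic polynomial of A and N_i is the i-th row sum of
adj(X - A). Integration by antiderivative proves this only far to the right. Since g ≥ 0, the
transform is holomorphic to the right of any point of absolute convergence, so the identity theorem
and a limit from the right carry it to every such point (`laplaceTransform_mul_eq_of_large`).

For partial fractions, split 1 into generalized eigenvectors v_z of A over ℂ. On v_z both the
Neumann series of the resolvent and the series of e^{tA} stop after finitely many terms. Both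
involve the same numbers c_{z,k} = ((A - z)^k v_z)_i, so no inversion of the Laplace transform is
needed. -/

namespace RegimeSwitching

/-! ### Lie-Trotter product formula in a real Banach algebra. -/

section Trotter

open Filter Topology

variable {𝔸 : Type*} [NormedRing 𝔸] [NormOneClass 𝔸]

/-- Telescoping bound for the difference of two powers. -/
theorem norm_pow_sub_pow_le {a b : 𝔸} {M : ℝ} (ha : ‖a‖ ≤ M) (hb : ‖b‖ ≤ M) (n : ℕ) :
    ‖a ^ (n + 1) - b ^ (n + 1)‖ ≤ (n + 1) * M ^ n * ‖a - b‖ := by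
  have hM : 0 ≤ M := (norm_nonneg a).trans ha
  induction n with
  | zero => simp
  | succ n ih =>
    have hbn : ‖b ^ (n + 1)‖ ≤ M ^ (n + 1) :=
      (norm_pow_le b _).trans (pow_le_pow_left₀ (norm_nonneg b) hb _)
    calc ‖a ^ (n + 1 + 1) - b ^ (n + 1 + 1)‖
        = ‖a * (a ^ (n + 1) - b ^ (n + 1)) + (a - b) * b ^ (n + 1)‖ := by
          congr 1; rw [pow_succ' a (n + 1), pow_succ' b (n + 1)]; noncomm_ring
      _ ≤ ‖a‖ * ‖a ^ (n + 1) - b ^ (n + 1)‖ + ‖a - b‖ * ‖b ^ (n + 1)‖ :=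
          (norm_add_le _ _).trans (add_le_add (norm_mul_le _ _) (norm_mul_le _ _))
      _ ≤ M * ((n + 1) * M ^ n * ‖a - b‖) + ‖a - b‖ * M ^ (n + 1) := by gcongr
      _ = ((n + 1 : ℕ) + 1) * M ^ (n + 1) * ‖a - b‖ := by push_cast; ring

variable [NormedAlgebra ℝ 𝔸] [CompleteSpace 𝔸]

theorem norm_exp_le_exp_norm (x : 𝔸) : ‖NormedSpace.exp x‖ ≤ Real.exp ‖x‖ := by
  have h := NormedSpace.exp_series_hasSum_exp' (𝕂 := ℝ) x
  have hr := NormedSpace.exp_series_hasSum_exp' (𝕂 := ℝ) ‖x‖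
  rw [← Real.exp_eq_exp_ℝ] at hr
  rw [← h.tsum_eq]
  refine tsum_of_norm_bounded hr fun n => ?_
  rw [norm_smul, smul_eq_mul, norm_inv, RCLike.norm_natCast]
  gcongr
  exact norm_pow_le x n

/-- The Lie-Trotter product formula. -/
theorem tendsto_exp_mul_exp_pow (x y : 𝔸) :
    Tendsto (fun n : ℕ => (NormedSpace.exp (((n : ℝ) + 1)⁻¹ • x) *
      NormedSpace.exp (((n : ℝ) + 1)⁻¹ • y)) ^ (n + 1)) atTop (𝓝 (NormedSpace.exp (x + y))) := by
  let _ : NormedAlgebra ℚ 𝔸 := NormedAlgebra.restrictScalars ℚ ℝ 𝔸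
  -- The one-step error satisfies f(0) = 0 and f'(0) = 0, so it is o(s). The telescoping bound
  -- multiplies it by n + 1 and a bounded factor, and (n + 1) ‖f (1/(n + 1))‖ tends to 0.
  set f : ℝ → 𝔸 := fun s => NormedSpace.exp (s • x) * NormedSpace.exp (s • y) -
    NormedSpace.exp (s • (x + y)) with hf
  have hf0 : f 0 = 0 := by simp [hf]
  have hder : HasDerivAt f 0 0 := by
    have h1 := hasDerivAt_exp_smul_const (𝕂 := ℝ) x (0 : ℝ)
    have h2 := hasDerivAt_exp_smul_const (𝕂 := ℝ) y (0 : ℝ)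
    have h3 := hasDerivAt_exp_smul_const (𝕂 := ℝ) (x + y) (0 : ℝ)
    have := (h1.mul h2).sub h3
    refine (this.congr_deriv ?_).congr_of_eventuallyEq (Eventually.of_forall fun s => rfl)
    simp
  have hs : Tendsto (fun n : ℕ => ((n : ℝ) + 1)⁻¹) atTop (𝓝[≠] 0) := by
    refine tendsto_nhdsWithin_iff.2 ⟨?_, Eventually.of_forall fun n => ?_⟩
    · simpa [one_div] using tendsto_one_div_add_atTop_nhds_zero_nat (𝕜 := ℝ)
    · exact inv_ne_zero (by positivity)
  have hslope : Tendsto (fun n : ℕ => ((n : ℝ) + 1) * ‖f (((n : ℝ) + 1)⁻¹)‖) atTop (𝓝 0) := by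
    have h := (hasDerivAt_iff_tendsto_slope_zero.1 hder).comp hs
    have h' := h.norm
    simp only [norm_zero] at h'
    refine h'.congr fun n => ?_
    have : (0 : ℝ) < (n : ℝ) + 1 := by positivity
    simp [hf0, norm_smul, abs_of_pos this]
  rw [tendsto_iff_norm_sub_tendsto_zero]
  refine squeeze_zero (fun _ => norm_nonneg _) (fun n => ?_)
    (by simpa using hslope.const_mul (Real.exp (‖x‖ + ‖y‖)))
  have hn : (0 : ℝ) < (n : ℝ) + 1 := by positivity
  set s : ℝ := ((n : ℝ) + 1)⁻¹ with hsdef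
  have hs0 : 0 < s := inv_pos.2 hn
  have hb : NormedSpace.exp (x + y) = NormedSpace.exp (s • (x + y)) ^ (n + 1) := by
    rw [← NormedSpace.exp_nsmul]
    congr 1
    rw [← Nat.cast_smul_eq_nsmul ℝ, smul_smul]
    push_cast
    rw [hsdef, mul_inv_cancel₀ hn.ne', one_smul]
  have hnorm : ∀ z : 𝔸, ‖s • z‖ = s * ‖z‖ := fun z => by
    rw [norm_smul, Real.norm_of_nonneg hs0.le]
  have hA : ‖NormedSpace.exp (s • x) * NormedSpace.exp (s • y)‖ ≤
      Real.exp (s * (‖x‖ + ‖y‖)) := by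
    rw [mul_add, Real.exp_add, ← hnorm, ← hnorm]
    exact (norm_mul_le _ _).trans (mul_le_mul (norm_exp_le_exp_norm _) (norm_exp_le_exp_norm _)
      (norm_nonneg _) (Real.exp_nonneg _))
  have hB : ‖NormedSpace.exp (s • (x + y))‖ ≤ Real.exp (s * (‖x‖ + ‖y‖)) := by
    refine (norm_exp_le_exp_norm _).trans (Real.exp_le_exp.2 ?_)
    rw [hnorm]
    exact mul_le_mul_of_nonneg_left (norm_add_le _ _) hs0.le
  rw [hb]
  refine (norm_pow_sub_pow_le hA hB n).trans ?_
  have hpow : Real.exp (s * (‖x‖ + ‖y‖)) ^ n ≤ Real.exp (‖x‖ + ‖y‖) := by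
    rw [← Real.exp_nat_mul]
    refine Real.exp_le_exp.2 ?_
    rw [← mul_assoc]
    refine mul_le_of_le_one_left (by positivity) ?_
    rw [hsdef, ← div_eq_mul_inv, div_le_one hn]
    linarith
  calc ((n : ℝ) + 1) * Real.exp (s * (‖x‖ + ‖y‖)) ^ n * ‖_‖
      ≤ ((n : ℝ) + 1) * Real.exp (‖x‖ + ‖y‖) * ‖f s‖ := by gcongr
    _ = _ := by ring

end Trotter

/-! ### Adjugate row sums, Cramer's rule and primary decomposition. -/

section Algebra

open Polynomial Matrix

variable {m : ℕ}

/-- The row sums of the adjugate of the characteristic matrix. -/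
noncomputable def adjugateRowSum {R : Type*} [CommRing R] (A : Matrix (Fin m) (Fin m) R)
    (i : Fin m) : R[X] := ∑ j, (charmatrix A).adjugate i j

/-- Apply (X - A) adj(X - A) = D · I to the all-ones vector: the row sums N solve (X - A) N = D · 1.
The degree and leading coefficient of N are read off from this recursion. -/
theorem X_mul_adjugateRowSum {R : Type*} [CommRing R] (A : Matrix (Fin m) (Fin m) R)
    (i : Fin m) :
    X * adjugateRowSum A i = A.charpoly + ∑ j, C (A i j) * adjugateRowSum A j := by
  have h := congrArg (fun M => (M *ᵥ fun _ => (1 : R[X])) i) (mul_adjugate (charmatrix A))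
  have hv : (charmatrix A).adjugate *ᵥ (fun _ => (1 : R[X])) = adjugateRowSum A := by
    ext1 j; simp [mulVec, dotProduct, adjugateRowSum]
  simp only [← mulVec_mulVec, hv] at h
  simp only [charmatrix, sub_mulVec, smul_mulVec, one_mulVec, Pi.sub_apply, Pi.smul_apply,
    smul_eq_mul, mul_one] at h
  rw [sub_eq_iff_eq_add] at h
  simpa [mulVec, dotProduct, charpoly, charmatrix, Matrix.scalar_apply, Matrix.diagonal_apply,
    Finset.sum_ite_eq] using h

/-- Descending induction from a degree bound B common to all rows: the recursion expresses
coefficient k through the coefficients k + 1, and D contributes nothing there because k + 1 > m. -/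
theorem coeff_adjugateRowSum_eq_zero {R : Type*} [CommRing R] [Nontrivial R]
    (A : Matrix (Fin m) (Fin m) R) {k : ℕ} (hk : m ≤ k) (i : Fin m) :
    (adjugateRowSum A i).coeff k = 0 := by
  obtain ⟨B, hB⟩ : ∃ B, ∀ k, B ≤ k → ∀ i, (adjugateRowSum A i).coeff k = 0 := by
    refine ⟨(Finset.univ.sup fun i => (adjugateRowSum A i).natDegree) + 1, fun k hk i =>
      coeff_eq_zero_of_natDegree_lt ?_⟩
    exact (Finset.le_sup (f := fun i => (adjugateRowSum A i).natDegree) (Finset.mem_univ i)).trans_lt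
      hk
  by_cases hkB : B ≤ k
  · exact hB k hkB i
  obtain ⟨d, rfl⟩ : ∃ d, B = k + d := ⟨B - k, by omega⟩
  clear hkB
  induction d generalizing k i with
  | zero => exact hB k le_rfl i
  | succ d ih =>
    have h := congrArg (fun p => p.coeff (k + 1)) (X_mul_adjugateRowSum A i)
    simp only [coeff_X_mul, coeff_add, finsetSum_coeff, coeff_C_mul] at h
    rw [h, coeff_eq_zero_of_natDegree_lt (by rw [charpoly_natDegree_eq_dim, Fintype.card_fin]; omega)]
    rw [zero_add]
    refine Finset.sum_eq_zero fun j _ => ?_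
    rw [ih (k := k + 1) (by omega) j (by rwa [show k + 1 + d = k + (d + 1) by omega]), mul_zero]

/-- Compare coefficients of X^m in the recursion: the sum over the N_j vanishes and D is monic of
degree m. -/
theorem coeff_adjugateRowSum_pred {R : Type*} [CommRing R] [Nontrivial R]
    (A : Matrix (Fin m) (Fin m) R) (i : Fin m) :
    (adjugateRowSum A i).coeff (m - 1) = 1 := by
  have hm : m - 1 + 1 = m := by have := i.pos; omega
  have h := congrArg (fun p => p.coeff (m - 1 + 1)) (X_mul_adjugateRowSum A i)
  simp only [coeff_X_mul, coeff_add, finsetSum_coeff, coeff_C_mul] at h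
  rw [h, hm, Finset.sum_eq_zero fun j _ => by rw [coeff_adjugateRowSum_eq_zero A le_rfl, mul_zero],
    add_zero]
  have hmon := charpoly_monic A
  rw [Monic, leadingCoeff, charpoly_natDegree_eq_dim, Fintype.card_fin] at hmon
  exact hmon

theorem natDegree_adjugateRowSum_le {R : Type*} [CommRing R] [Nontrivial R]
    (A : Matrix (Fin m) (Fin m) R) (i : Fin m) : (adjugateRowSum A i).natDegree ≤ m - 1 :=
  natDegree_le_iff_coeff_eq_zero.2 fun k hk => coeff_adjugateRowSum_eq_zero A (by omega) i

theorem monic_adjugateRowSum {R : Type*} [CommRing R] [Nontrivial R]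
    (A : Matrix (Fin m) (Fin m) R) (i : Fin m) : (adjugateRowSum A i).Monic :=
  monic_of_natDegree_le_of_coeff_eq_one (m - 1) (natDegree_adjugateRowSum_le A i)
    (coeff_adjugateRowSum_pred A i)

theorem natDegree_adjugateRowSum {R : Type*} [CommRing R] [Nontrivial R]
    (A : Matrix (Fin m) (Fin m) R) (i : Fin m) : (adjugateRowSum A i).natDegree = m - 1 :=
  le_antisymm (natDegree_adjugateRowSum_le A i)
    (le_natDegree_of_ne_zero (by rw [coeff_adjugateRowSum_pred]; exact one_ne_zero))

theorem aeval_charpoly_eq_det (A : Matrix (Fin m) (Fin m) ℝ) (u : ℂ) :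
    aeval u A.charpoly = (scalar (Fin m) u - A.map (algebraMap ℝ ℂ)).det := by
  rw [aeval_def, ← eval_map, ← charpoly_map, eval_charpoly]

/-- A vector satisfying the resolvent equation is given by the adjugate row sums. -/
theorem resolvent_eq_div (A : Matrix (Fin m) (Fin m) ℝ) {u : ℂ} (hu : aeval u A.charpoly ≠ 0)
    {w : Fin m → ℂ} (hw : (scalar (Fin m) u - A.map (algebraMap ℝ ℂ)) *ᵥ w = fun _ => 1)
    (i : Fin m) : w i = aeval u (adjugateRowSum A i) / aeval u A.charpoly := by
  set B := scalar (Fin m) u - A.map (algebraMap ℝ ℂ) with hB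
  have hN : ∀ i, (B *ᵥ fun j => aeval u (adjugateRowSum A j)) i = aeval u A.charpoly := by
    intro i
    have h := congrArg (aeval u) (X_mul_adjugateRowSum A i)
    simp only [map_mul, aeval_X, map_add, map_sum, aeval_C] at h
    rw [hB, sub_mulVec, Pi.sub_apply, sub_eq_iff_eq_add]
    simpa [mulVec, dotProduct, scalar_apply, diagonal_apply] using h
  have hdet : IsUnit B.det := by rw [hB, ← aeval_charpoly_eq_det]; exact hu.isUnit
  have hinj := mulVec_injective_of_isUnit ((isUnit_iff_isUnit_det B).2 hdet)
  have : w = (aeval u A.charpoly)⁻¹ • fun j => aeval u (adjugateRowSum A j) := by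
    apply hinj
    simp only [mulVec_smul]
    ext j
    rw [hw, Pi.smul_apply, hN, smul_eq_mul, inv_mul_cancel₀ hu]
  rw [this, Pi.smul_apply, smul_eq_mul, div_eq_inv_mul]

/-- Primary decomposition of a vector with respect to a complex matrix. -/
theorem exists_primary_decomposition {K : Type*} [Field K] [IsAlgClosed K] [DecidableEq K]
    (B : Matrix (Fin m) (Fin m) K) (x : Fin m → K) :
    ∃ v : K → Fin m → K, ∑ z ∈ B.charpoly.roots.toFinset, v z = x ∧
      ∀ z ∈ B.charpoly.roots.toFinset,
        ((B - scalar (Fin m) z) ^ (B.charpoly.roots.count z)) *ᵥ v z = 0 := by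
  set D := B.charpoly with hD
  set S := D.roots.toFinset with hS
  set s : K → K[X] := fun z => (X - C z) ^ D.roots.count z with hs
  have hprod : ∏ z ∈ S, s z = D := by
    rw [← Finset.prod_multiset_map_count]
    have := (IsAlgClosed.splits D).eq_prod_roots_of_monic (charpoly_monic B)
    exact this.symm
  -- The Bézout identity below needs at least one factor. Without roots D = 1, and Cayley-Hamilton
  -- forces 1 = 0, so every vector is zero.
  rcases S.eq_empty_or_nonempty with hSe | hSn
  · have h1 : D = 1 := by rw [← hprod, hSe, Finset.prod_empty]
    have h0 : (1 : Matrix (Fin m) (Fin m) K) = 0 := by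
      have := aeval_self_charpoly B
      rwa [← hD, h1, map_one] at this
    refine ⟨fun _ => 0, ?_, fun z _ => mulVec_zero _⟩
    rw [hSe, Finset.sum_empty, ← one_mulVec x, h0, zero_mulVec]
  have hcop : Pairwise (Function.onFun IsCoprime fun z : S => s z) := by
    intro z w hzw
    exact (isCoprime_X_sub_C_of_isUnit_sub
      (sub_ne_zero.2 fun h => hzw (Subtype.ext h)).isUnit).pow
  -- Bézout for the coprime factors s_z. The z-th summand evaluated at B projects x to its
  -- component, which s_z(B) kills since the product is a multiple of D(B) = 0.
  obtain ⟨μ, hμ⟩ := (exists_sum_eq_one_iff_pairwise_coprime hSn).2 hcop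
  refine ⟨fun z => aeval B (μ z * ∏ w ∈ S \ {z}, s w) *ᵥ x, ?_, fun z hz => ?_⟩
  · rw [← sum_mulVec, ← map_sum, hμ, map_one, one_mulVec]
  · have h1 : (B - scalar (Fin m) z) ^ D.roots.count z = aeval B (s z) := by
      simp [hs, Matrix.algebraMap_eq_diagonal, scalar_apply, Pi.algebraMap_def]
    have h2 : s z * (μ z * ∏ w ∈ S \ {z}, s w) = μ z * D := by
      rw [← hprod, ← Finset.mul_prod_erase S s hz, Finset.sdiff_singleton_eq_erase]; ring
    rw [h1, mulVec_mulVec, ← map_mul, h2, map_mul, hD, aeval_self_charpoly, mul_zero, zero_mulVec]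

/-- The resolvent applied to a generalized eigenvector. -/
theorem resolvent_mulVec_generalized {K : Type*} [Field K] (B : Matrix (Fin m) (Fin m) K)
    {z u : K} (hu : u - z ≠ 0) {n : ℕ} {v : Fin m → K}
    (hv : ((B - scalar (Fin m) z) ^ n) *ᵥ v = 0) :
    (scalar (Fin m) u - B) *ᵥ
      (∑ k ∈ Finset.range n, ((u - z) ^ (k + 1))⁻¹ • ((B - scalar (Fin m) z) ^ k *ᵥ v)) = v := by
  set E := B - scalar (Fin m) z with hE
  have hsub : scalar (Fin m) u - B = scalar (Fin m) (u - z) - E := by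
    rw [hE, map_sub]; abel
  -- Since u - B = (u - z) - E, each term of the Neumann series becomes a difference. The sum
  -- telescopes to v, because E^n v = 0.
  have hterm : ∀ k, (scalar (Fin m) u - B) *ᵥ (((u - z) ^ (k + 1))⁻¹ • (E ^ k *ᵥ v)) =
      ((u - z) ^ k)⁻¹ • (E ^ k *ᵥ v) - ((u - z) ^ (k + 1))⁻¹ • (E ^ (k + 1) *ᵥ v) := by
    intro k
    have hk : (u - z) ^ k ≠ 0 := pow_ne_zero k hu
    have h1 : scalar (Fin m) (u - z) *ᵥ (((u - z) ^ (k + 1))⁻¹ • (E ^ k *ᵥ v)) =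
        ((u - z) ^ k)⁻¹ • (E ^ k *ᵥ v) := by
      rw [scalar_apply, ← smul_one_eq_diagonal, smul_mulVec, one_mulVec, smul_smul]
      congr 1
      rw [pow_succ]
      field_simp
    rw [hsub, sub_mulVec, h1, mulVec_smul E, mulVec_mulVec, ← pow_succ']
  rw [mulVec_sum, Finset.sum_congr rfl fun k _ => hterm k, Finset.sum_range_sub']
  simp [hv]

end Algebra

/-! ### Matrix exponentials acting on vectors. -/

section MatrixExponential

open Matrix Filter Topology

variable {m : ℕ}

/-- The exponential applied to a generalized eigenvector. -/
theorem exp_smul_mulVec_generalized (B : Matrix (Fin m) (Fin m) ℂ) {z : ℂ} (t : ℝ) {n : ℕ}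
    {v : Fin m → ℂ} (hv : ((B - scalar (Fin m) z) ^ n) *ᵥ v = 0) :
    NormedSpace.exp ((t : ℂ) • B) *ᵥ v = ∑ k ∈ Finset.range n,
      (((t : ℂ) ^ k / (k.factorial : ℂ)) * Complex.exp (z * t)) •
        ((B - scalar (Fin m) z) ^ k *ᵥ v) := by
  open scoped Matrix.Norms.Operator in
  set E := B - scalar (Fin m) z with hE
  -- The scalar part commutes with E, so e^{tB} = e^{tz} e^{tE}, and the series of e^{tE} v stops at
  -- n.
  have hsplit : (t : ℂ) • B = (t : ℂ) • scalar (Fin m) z + (t : ℂ) • E := by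
    rw [← smul_add, hE, add_sub_cancel]
  have hcomm : Commute ((t : ℂ) • scalar (Fin m) z) ((t : ℂ) • E) :=
    ((scalar_commute z (fun r => Commute.all _ _) E).smul_left _).smul_right _
  have hscal : NormedSpace.exp ((t : ℂ) • scalar (Fin m) z) =
      Complex.exp (z * t) • (1 : Matrix (Fin m) (Fin m) ℂ) := by
    rw [scalar_apply, ← diagonal_smul, Matrix.exp_diagonal, smul_one_eq_diagonal]
    congr 1
    ext j
    rw [Pi.coe_exp, Complex.exp_eq_exp_ℂ]
    simp [mul_comm]
  have hsum := NormedSpace.exp_series_hasSum_exp' (𝕂 := ℂ) ((t : ℂ) • E)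
  have hsum' : HasSum (fun k : ℕ => (((k.factorial : ℂ)⁻¹) • ((t : ℂ) • E) ^ k) *ᵥ v)
      (NormedSpace.exp ((t : ℂ) • E) *ᵥ v) :=
    hsum.map (AddMonoidHom.mk' (fun M : Matrix (Fin m) (Fin m) ℂ => M *ᵥ v)
      fun M N => add_mulVec M N v) (Continuous.matrix_mulVec continuous_id continuous_const)
  have hzero : ∀ k, k ∉ Finset.range n → (((k.factorial : ℂ)⁻¹) • ((t : ℂ) • E) ^ k) *ᵥ v = 0 := by
    intro k hk
    have : E ^ k *ᵥ v = 0 := by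
      rw [← Nat.sub_add_cancel (not_lt.1 fun h => hk (Finset.mem_range.2 h)), pow_add,
        ← mulVec_mulVec, hv, mulVec_zero]
    rw [smul_pow, smul_smul, smul_mulVec, this, smul_zero]
  rw [hsplit, Matrix.exp_add_of_commute _ _ hcomm, hscal, smul_mul_assoc, one_mul, smul_mulVec,
    hsum'.unique (hasSum_sum_of_ne_finset_zero hzero), Finset.smul_sum]
  refine Finset.sum_congr rfl fun k _ => ?_
  rw [smul_pow, smul_smul, smul_mulVec, smul_smul]
  congr 1
  ring

theorem map_exp_smul (A : Matrix (Fin m) (Fin m) ℝ) (t : ℝ) :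
    (NormedSpace.exp (t • A)).map (algebraMap ℝ ℂ) =
      NormedSpace.exp ((t : ℂ) • A.map (algebraMap ℝ ℂ)) := by
  open scoped Matrix.Norms.Operator in
  have h := NormedSpace.map_exp (𝔸 := Matrix (Fin m) (Fin m) ℝ) (𝔹 := Matrix (Fin m) (Fin m) ℂ)
    (algebraMap ℝ ℂ).mapMatrix (Continuous.matrix_map continuous_id Complex.continuous_ofReal)
    (t • A)
  have h2 : (algebraMap ℝ ℂ).mapMatrix (t • A) = (t : ℂ) • A.map (algebraMap ℝ ℂ) := by
    ext i j; simp
  rw [h2] at h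
  exact h

theorem hasDerivAt_exp_smul_mulVec (B : Matrix (Fin m) (Fin m) ℂ) (w : Fin m → ℂ) (i : Fin m)
    (t : ℝ) :
    HasDerivAt (fun t : ℝ => (NormedSpace.exp ((t : ℂ) • B) *ᵥ w) i)
      ((NormedSpace.exp ((t : ℂ) • B) *ᵥ (B *ᵥ w)) i) t := by
  open scoped Matrix.Norms.Operator in
  have h := hasDerivAt_exp_smul_const (𝕂 := ℝ) B t
  let φ : Matrix (Fin m) (Fin m) ℂ →L[ℝ] ℂ :=
    LinearMap.toContinuousLinearMap
      { toFun := fun M => (M *ᵥ w) i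
        map_add' := fun M N => by rw [add_mulVec, Pi.add_apply]
        map_smul' := fun r M => by rw [smul_mulVec, Pi.smul_apply, RingHom.id_apply] }
  have h2 := φ.hasFDerivAt.comp_hasDerivAt t h
  rw [mulVec_mulVec]
  simp only [Complex.coe_smul]
  exact h2

theorem exists_norm_exp_smul_mulVec_le (B : Matrix (Fin m) (Fin m) ℂ) (i : Fin m) :
    ∃ K : ℝ, ∀ (w : Fin m → ℂ) (t : ℝ), 0 ≤ t →
      ‖(NormedSpace.exp ((t : ℂ) • B) *ᵥ w) i‖ ≤ ‖w‖ * Real.exp (K * t) := by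
  open scoped Matrix.Norms.Operator in
  have : Nonempty (Fin m) := ⟨i⟩
  refine ⟨‖B‖, fun w t ht => ?_⟩
  refine (norm_le_pi_norm _ i).trans ((linfty_opNorm_mulVec _ _).trans ?_)
  rw [mul_comm]
  refine mul_le_mul_of_nonneg_left ((norm_exp_le_exp_norm _).trans (Real.exp_le_exp.2 ?_))
    (norm_nonneg w)
  rw [norm_smul, Complex.norm_real, Real.norm_of_nonneg ht, mul_comm]

end MatrixExponential

/-! ### Riemann sums along right-continuous paths. -/

section RiemannSum

open Filter Topology

/-- Right-endpoint Riemann sums of a right-continuous path in a finite space converge. -/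
theorem tendsto_riemannSum_of_rightContinuous {m : ℕ} (δ : Fin m → ℝ) {f : ℝ≥0 → Fin m}
    (hf : ∀ t, ContinuousWithinAt f (Set.Ici t) t) {T : ℝ≥0} (hT : 0 < T) :
    Tendsto (fun n : ℕ => ∑ k ∈ Finset.range (n + 1),
      ((T : ℝ) / (n + 1)) * δ (f ((k + 1 : ℕ) * (T / (n + 1))))) atTop
      (𝓝 (∫ u in (0 : ℝ)..T, δ (f u.toNNReal))) := by
  set h : ℕ → ℝ≥0 := fun n => T / (n + 1) with hh
  have hpos : ∀ n, 0 < h n := fun n => by positivity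
  have hcoe : ∀ n, ((h n : ℝ≥0) : ℝ) = (T : ℝ) / (n + 1) := fun n => by simp [hh]
  -- The path sampled at the first grid point not before u. Its integral is exactly the Riemann sum,
  -- and the sampling times approach u from the right, so right-continuity gives pointwise
  -- convergence.
  set F : ℕ → ℝ → ℝ := fun n u => δ (f (⌈u / h n⌉₊ * h n)) with hF
  have hFm : ∀ n, Measurable (F n) := fun n =>
    (measurable_from_nat (f := fun k : ℕ => δ (f (k * h n)))).comp
      (Nat.measurable_ceil.comp (measurable_id.div_const _))
  have hFb : ∀ n u, ‖F n u‖ ≤ ∑ j, |δ j| := fun n u =>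
    Finset.single_le_sum (f := fun j => |δ j|) (fun j _ => abs_nonneg _) (Finset.mem_univ _)
  have hFi : ∀ n a b, IntervalIntegrable (F n) volume a b := fun n a b =>
    (intervalIntegrable_const (c := ∑ j, |δ j|)).mono_fun (hFm n).aestronglyMeasurable
      (Eventually.of_forall fun u => (hFb n u).trans (le_abs_self _))
  have hpiece : ∀ n k : ℕ, ∫ u in ((k : ℕ) * (h n : ℝ))..((k + 1 : ℕ) * (h n : ℝ)), F n u =
      (h n : ℝ) * δ (f ((k + 1 : ℕ) * h n)) := by
    intro n k
    have hn : (0 : ℝ) < h n := hpos n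
    rw [intervalIntegral.integral_congr_ae (g := fun _ => δ (f ((k + 1 : ℕ) * h n)))]
    · rw [intervalIntegral.integral_const, smul_eq_mul]
      push_cast; ring
    · refine Eventually.of_forall fun u hu => ?_
      rw [Set.uIoc_of_le (by push_cast; nlinarith)] at hu
      have : ⌈u / h n⌉₊ = k + 1 := by
        rw [Nat.ceil_eq_iff (Nat.succ_ne_zero k)]
        refine ⟨?_, (div_le_iff₀ hn).2 hu.2⟩
        rw [lt_div_iff₀ hn]
        simpa using hu.1
      simp only [hF, this]
  have hsum : ∀ n, ∫ u in (0 : ℝ)..T, F n u = ∑ k ∈ Finset.range (n + 1),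
      ((T : ℝ) / (n + 1)) * δ (f ((k + 1 : ℕ) * (T / (n + 1)))) := by
    intro n
    have := intervalIntegral.sum_integral_adjacent_intervals (f := F n) (μ := volume)
      (a := fun k : ℕ => (k : ℝ) * (h n : ℝ)) (n := n + 1) fun k _ => hFi n _ _
    have hend : ((n + 1 : ℕ) : ℝ) * (h n : ℝ) = T := by
      rw [hcoe]; push_cast; field_simp
    simp only [Nat.cast_zero, zero_mul, hend] at this
    rw [← this]
    exact Finset.sum_congr rfl fun k _ => by rw [hpiece, hcoe]
  refine Tendsto.congr hsum ?_
  refine intervalIntegral.tendsto_integral_filter_of_dominated_convergence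
    (fun _ => ∑ j, |δ j|) (Eventually.of_forall fun n => (hFm n).aestronglyMeasurable)
    (Eventually.of_forall fun n => Eventually.of_forall fun u _ => hFb n u)
    intervalIntegrable_const (Eventually.of_forall fun u hu => ?_)
  rw [Set.uIoc_of_le T.coe_nonneg] at hu
  have hδ : ContinuousWithinAt (fun s => δ (f s)) (Set.Ici u.toNNReal) u.toNNReal :=
    (continuous_of_discreteTopology (f := δ)).continuousAt.comp_continuousWithinAt (hf _)
  refine hδ.tendsto.comp (tendsto_nhdsWithin_iff.2 ⟨?_, Eventually.of_forall fun n => ?_⟩)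
  · rw [← NNReal.tendsto_coe, Real.coe_toNNReal _ hu.1.le]
    have hh0 : Tendsto (fun n : ℕ => (T : ℝ) / (n + 1)) atTop (𝓝 0) := by
      simpa [div_eq_mul_inv] using (tendsto_one_div_add_atTop_nhds_zero_nat (𝕜 := ℝ)).const_mul T.1
    refine tendsto_of_tendsto_of_tendsto_of_le_of_le tendsto_const_nhds
      (by simpa using hh0.const_add u) (fun n => ?_) fun n => ?_
    · have hn : (0 : ℝ) < h n := hpos n
      push_cast
      exact (div_le_iff₀ hn).1 (Nat.le_ceil _)
    · have hn : (0 : ℝ) < h n := hpos n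
      have := (Nat.ceil_lt_add_one (div_nonneg hu.1.le hn.le)).le
      have h2 := mul_le_mul_of_nonneg_right this hn.le
      rw [add_mul, div_mul_cancel₀ _ hn.ne', one_mul] at h2
      push_cast
      rw [← hcoe]
      exact h2
  · have hn : (0 : ℝ) < h n := hpos n
    rw [Set.mem_Ici, ← NNReal.coe_le_coe, Real.coe_toNNReal _ hu.1.le]
    push_cast
    exact (div_le_iff₀ hn).1 (Nat.le_ceil _)

end RiemannSum

/-! ### The Markov property and the Feynman-Kac formula. -/

section MarkovChain

open Filter Topology Matrix

variable {Ω : Type*} [MeasurableSpace Ω] {P : Measure Ω} {m : ℕ}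
  {Q : Matrix (Fin m) (Fin m) ℝ} {Y : ℝ≥0 → Ω → Fin m}

theorem IsMarkovChain.history_le (hY : IsMarkovChain P Q Y) (s : ℝ≥0) :
    history Y s ≤ ‹MeasurableSpace Ω› :=
  iSup_le fun u => (hY.measurable u).comap_le

omit [MeasurableSpace Ω] in
theorem measurable_history {s u : ℝ≥0} (hus : u ≤ s) : Measurable[history Y s] (Y u) :=
  Measurable.of_comap_le (le_iSup (fun u : Set.Iic s => MeasurableSpace.comap (Y u) ⊤) ⟨u, hus⟩)

/-- The discounting factor along the grid of mesh `h`. -/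
noncomputable def gridDiscount (Y : ℝ≥0 → Ω → Fin m) (δ : Fin m → ℝ) (h : ℝ≥0) (n : ℕ) (ω : Ω) :
    ℝ := ∏ k ∈ Finset.range n, Real.exp (-((h : ℝ) * δ (Y ((k + 1 : ℕ) * h) ω)))

omit [MeasurableSpace Ω] in
theorem gridDiscount_pos (Y : ℝ≥0 → Ω → Fin m) (δ : Fin m → ℝ) (h : ℝ≥0) (n : ℕ) (ω : Ω) :
    0 < gridDiscount Y δ h n ω := Finset.prod_pos fun _ _ => Real.exp_pos _

omit [MeasurableSpace Ω] in
theorem gridDiscount_le (Y : ℝ≥0 → Ω → Fin m) {δ : Fin m → ℝ} {d : ℝ} (hd : ∀ j, d ≤ δ j)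
    (h : ℝ≥0) (n : ℕ) (ω : Ω) : gridDiscount Y δ h n ω ≤ Real.exp (-(d * (n * h))) := by
  have : Real.exp (-(d * (n * h))) = ∏ _k ∈ Finset.range n, Real.exp (-(h * d)) := by
    rw [Finset.prod_const, Finset.card_range, ← Real.exp_nat_mul]
    congr 1; ring
  rw [this]
  refine Finset.prod_le_prod (fun _ _ => (Real.exp_pos _).le) fun k _ => ?_
  gcongr
  exact hd _

omit [MeasurableSpace Ω] in
theorem stronglyMeasurable_gridDiscount (δ : Fin m → ℝ) (h : ℝ≥0) (n : ℕ) :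
    StronglyMeasurable[history Y (n * h)] (gridDiscount Y δ h n) := by
  refine Measurable.stronglyMeasurable ?_
  refine Finset.measurable_fun_prod _ fun k hk => ?_
  have hle : ((k + 1 : ℕ) : ℝ≥0) * h ≤ n * h := by
    have : k + 1 ≤ n := Finset.mem_range.1 hk
    gcongr
  exact (measurable_of_finite fun j => Real.exp (-((h : ℝ) * δ j))).comp (measurable_history hle)

/-- The grid discount factors converge almost surely. -/
theorem IsMarkovChain.tendsto_gridDiscount (hY : IsMarkovChain P Q Y) (δ : Fin m → ℝ)
    {T : ℝ≥0} (hT : 0 < T) :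
    ∀ᵐ ω ∂P, Tendsto (fun n : ℕ => gridDiscount Y δ (T / (n + 1)) (n + 1) ω) atTop
      (𝓝 (Real.exp (-∫ u in (0 : ℝ)..T, δ (Y u.toNNReal ω)))) := by
  filter_upwards [hY.rightContinuous] with ω hω
  refine ((Real.continuous_exp.tendsto _).comp
    (tendsto_riemannSum_of_rightContinuous δ hω hT).neg).congr fun n => ?_
  simp [gridDiscount, ← Real.exp_sum]

theorem g_nonneg (P : Measure Ω) (Y : ℝ≥0 → Ω → Fin m) (δ : Fin m → ℝ) (i : Fin m) (t : ℝ) :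
    0 ≤ g P Y δ i t := integral_nonneg fun _ => (Real.exp_pos _).le

variable [IsProbabilityMeasure P]

theorem IsMarkovChain.integrable_comp (hY : IsMarkovChain P Q Y) (ψ : Fin m → ℝ) (t : ℝ≥0) :
    Integrable (fun ω => ψ (Y t ω)) P :=
  Integrable.of_bound ((measurable_of_finite ψ).comp (hY.measurable t)).aestronglyMeasurable
    (∑ j, |ψ j|) (Eventually.of_forall fun _ =>
      Finset.single_le_sum (f := fun j => |ψ j|) (fun _ _ => abs_nonneg _) (Finset.mem_univ _))

/-- The Markov property for functions of the state. -/
theorem IsMarkovChain.condExp_comp (hY : IsMarkovChain P Q Y) {s t : ℝ≥0} (hst : s ≤ t)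
    (ψ : Fin m → ℝ) :
    P[fun ω => ψ (Y t ω) | history Y s] =ᵐ[P]
      fun ω => (NormedSpace.exp (((t : ℝ) - (s : ℝ)) • Q) *ᵥ ψ) (Y s ω) := by
  have hdecomp : (fun ω => ψ (Y t ω)) =
      ∑ j, ψ j • (Y t ⁻¹' {j}).indicator (fun _ => (1 : ℝ)) := by
    classical
    ext ω
    simp [Set.indicator_apply]
  have hint : ∀ j, Integrable ((Y t ⁻¹' {j}).indicator (fun _ => (1 : ℝ))) P := fun j =>
    (integrable_const 1).indicator (hY.measurable t (measurableSet_singleton j))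
  have hall : ∀ᵐ ω ∂P, ∀ j, (P[ψ j • (Y t ⁻¹' {j}).indicator (fun _ => (1 : ℝ)) | history Y s]) ω =
      ψ j * NormedSpace.exp (((t : ℝ) - (s : ℝ)) • Q) (Y s ω) j := by
    rw [ae_all_iff]
    intro j
    filter_upwards [condExp_smul (μ := P) (ψ j) ((Y t ⁻¹' {j}).indicator (fun _ => (1 : ℝ)))
      (history Y s), hY.markov s t hst j] with ω h1 h2
    rw [h1, Pi.smul_apply, h2, smul_eq_mul]
  rw [hdecomp]
  filter_upwards [condExp_finsetSum (μ := P) (s := Finset.univ)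
    (fun j _ => (hint j).smul (ψ j)) (history Y s), hall] with ω h1 h2
  rw [h1, Finset.sum_apply, Finset.sum_congr rfl fun j _ => h2 j]
  simp [mulVec, dotProduct, mul_comm]

/-- Tower property: condition on the history up to s and pull out the factor X, which is known at
that time. -/
theorem IsMarkovChain.integral_mul_comp (hY : IsMarkovChain P Q Y) {s t : ℝ≥0} (hst : s ≤ t)
    (ψ : Fin m → ℝ) {X : Ω → ℝ} (hX : StronglyMeasurable[history Y s] X) {C : ℝ}
    (hC : ∀ ω, |X ω| ≤ C) :
    ∫ ω, X ω * ψ (Y t ω) ∂P =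
      ∫ ω, X ω * (NormedSpace.exp (((t : ℝ) - (s : ℝ)) • Q) *ᵥ ψ) (Y s ω) ∂P := by
  have h1 := condExp_stronglyMeasurable_mul_of_bound (hY.history_le s) hX (hY.integrable_comp ψ t) C
    (Eventually.of_forall hC)
  rw [← integral_condExp (hY.history_le s)]
  refine integral_congr_ae ?_
  filter_upwards [h1, hY.condExp_comp hst ψ] with ω h1 h2
  have h1' : (P[fun ω => X ω * ψ (Y t ω) | history Y s]) ω =
    X ω * (P[fun ω => ψ (Y t ω) | history Y s]) ω := h1
  rw [h1', h2]

/-- Finite-dimensional distributions: the expected discounted value of a function along a grid. -/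
theorem IsMarkovChain.integral_gridDiscount_mul (hY : IsMarkovChain P Q Y) (δ : Fin m → ℝ)
    (i : Fin m) (h : ℝ≥0) (n : ℕ) (φ : Fin m → ℝ) :
    ∫ ω, ((Y 0 ⁻¹' {i}).indicator (fun _ => (1 : ℝ)) ω * gridDiscount Y δ h n ω) * φ (Y (n * h) ω) ∂P =
      P.real (Y 0 ⁻¹' {i}) *
        (((NormedSpace.exp ((h : ℝ) • Q) * NormedSpace.exp ((h : ℝ) • diagonal (-δ))) ^ n) *ᵥ φ) i := by
  induction n generalizing φ with
  | zero =>
    have : (fun ω => ((Y 0 ⁻¹' {i}).indicator (fun _ => (1 : ℝ)) ω * gridDiscount Y δ h 0 ω) *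
        φ (Y ((0 : ℕ) * h) ω)) = (Y 0 ⁻¹' {i}).indicator (fun _ => φ i) := by
      classical
      ext ω
      by_cases hω : Y 0 ω = i <;> simp [gridDiscount, hω]
    rw [this, integral_indicator_const _ (hY.measurable 0 (measurableSet_singleton i))]
    simp
  | succ n ih =>
    -- The newest discount factor depends only on the state at the last grid point, so it is
    -- absorbed into the test function. Conditioning one step back then produces e^{hQ} ψ, to which
    -- the induction hypothesis applies; hence φ is generalized.
    set ψ : Fin m → ℝ := NormedSpace.exp ((h : ℝ) • diagonal (-δ)) *ᵥ φ with hψ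
    have hψ' : ∀ j, ψ j = Real.exp (-((h : ℝ) * δ j)) * φ j := by
      intro j
      rw [hψ, ← diagonal_smul, Matrix.exp_diagonal, mulVec_diagonal, Pi.coe_exp,
        ← Real.exp_eq_exp_ℝ]
      simp
    have hle : (n : ℝ≥0) * h ≤ (n + 1 : ℕ) * h := by gcongr; simp
    have hsub : ((((n + 1 : ℕ) : ℝ≥0) * h : ℝ≥0) : ℝ) - ((n * h : ℝ≥0) : ℝ) = h := by
      push_cast; ring
    have hX : StronglyMeasurable[history Y (n * h)] fun ω =>
        (Y 0 ⁻¹' {i}).indicator (fun _ => (1 : ℝ)) ω * gridDiscount Y δ h n ω :=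
      (stronglyMeasurable_const.indicator
        (measurable_history zero_le (measurableSet_singleton i))).mul
        (stronglyMeasurable_gridDiscount δ h n)
    have hC : ∀ ω, |(Y 0 ⁻¹' {i}).indicator (fun _ => (1 : ℝ)) ω * gridDiscount Y δ h n ω| ≤
        Real.exp (-(-(∑ j, |δ j|) * (n * h))) := by
      intro ω
      rw [abs_mul, abs_of_pos (gridDiscount_pos Y δ h n ω)]
      refine (mul_le_of_le_one_left (gridDiscount_pos Y δ h n ω).le ?_).trans
        (gridDiscount_le Y (fun j => ?_) h n ω)
      · classical
        rw [Set.indicator_apply]; split_ifs <;> simp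
      · exact neg_le.1 ((neg_le_abs _).trans (Finset.single_le_sum (f := fun j => |δ j|)
          (fun j _ => abs_nonneg _) (Finset.mem_univ _)))
    have h1 := hY.integral_mul_comp hle ψ hX hC
    rw [hsub, ih] at h1
    rw [pow_succ, ← mulVec_mulVec, ← mulVec_mulVec, ← hψ, ← h1]
    congr 1
    ext ω
    rw [hψ', gridDiscount, Finset.prod_range_succ, ← gridDiscount]
    ring

theorem IsMarkovChain.integral_cond_gridDiscount (hY : IsMarkovChain P Q Y) (δ : Fin m → ℝ)
    {i : Fin m} (hi : P (Y 0 ⁻¹' {i}) ≠ 0) (h : ℝ≥0) (n : ℕ) :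
    ∫ ω, gridDiscount Y δ h n ω ∂(cond P (Y 0 ⁻¹' {i})) =
      (((NormedSpace.exp ((h : ℝ) • Q) * NormedSpace.exp ((h : ℝ) • diagonal (-δ))) ^ n) *ᵥ
        fun _ => 1) i := by
  have hms := hY.measurable 0 (measurableSet_singleton i)
  have hne : P.real (Y 0 ⁻¹' {i}) ≠ 0 := by
    rwa [Ne, measureReal_eq_zero_iff]
  have h1 := hY.integral_gridDiscount_mul δ i h n fun _ => 1
  rw [ProbabilityTheory.cond, integral_smul_measure, ← integral_indicator hms, ENNReal.toReal_inv, smul_eq_mul,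
    ← Measure.real, inv_mul_eq_iff_eq_mul₀ hne, ← h1]
  congr 1
  classical
  ext ω
  simp [Set.indicator_apply]

/-- The Feynman-Kac formula for the discounted survival function. -/
theorem IsMarkovChain.g_eq_exp (hY : IsMarkovChain P Q Y) (δ : Fin m → ℝ) {i : Fin m}
    (hi : P (Y 0 ⁻¹' {i}) ≠ 0) {t : ℝ} (ht : 0 ≤ t) :
    g P Y δ i t = (NormedSpace.exp (t • (Q - diagonal δ)) *ᵥ fun _ => 1) i := by
  open scoped Matrix.Norms.Operator in
  have : Nonempty (Fin m) := ⟨i⟩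
  have := cond_isProbabilityMeasure hi
  rcases ht.eq_or_lt with rfl | htpos
  · simp [g]
  lift t to ℝ≥0 using ht
  have hT : 0 < t := by exact_mod_cast htpos
  -- The same sequence of grid expectations is given two limits: g by dominated convergence, the
  -- matrix exponential by Lie-Trotter.
  have hlim1 : Tendsto (fun n : ℕ => ∫ ω, gridDiscount Y δ (t / (n + 1)) (n + 1) ω
      ∂(cond P (Y 0 ⁻¹' {i}))) atTop (𝓝 (g P Y δ i t)) := by
    refine tendsto_integral_of_dominated_convergence (fun _ => Real.exp ((∑ j, |δ j|) * t))
      (fun n => ((stronglyMeasurable_gridDiscount δ _ _).mono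
        (hY.history_le _)).aestronglyMeasurable) (integrable_const _)
      (fun n => Eventually.of_forall fun ω => ?_)
      (cond_absolutelyContinuous.ae_le (hY.tendsto_gridDiscount δ hT))
    rw [Real.norm_of_nonneg (gridDiscount_pos ..).le]
    refine (gridDiscount_le Y (d := -∑ j, |δ j|) (fun j => neg_le.1 ((neg_le_abs _).trans
      (Finset.single_le_sum (f := fun j => |δ j|) (fun j _ => abs_nonneg _)
        (Finset.mem_univ _)))) _ _ ω).trans_eq ?_
    congr 1
    push_cast
    field_simp
  have hlim2 : Tendsto (fun n : ℕ => ∫ ω, gridDiscount Y δ (t / (n + 1)) (n + 1) ω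
      ∂(cond P (Y 0 ⁻¹' {i}))) atTop
      (𝓝 ((NormedSpace.exp ((t : ℝ) • (Q - diagonal δ)) *ᵥ fun _ => 1) i)) := by
    have h := tendsto_exp_mul_exp_pow ((t : ℝ) • Q) ((t : ℝ) • diagonal (-δ))
    have hsum : (t : ℝ) • Q + (t : ℝ) • diagonal (-δ) = (t : ℝ) • (Q - diagonal δ) := by
      rw [← smul_add, sub_eq_add_neg, diagonal_neg]; rfl
    rw [hsum] at h
    have hc : Continuous fun M : Matrix (Fin m) (Fin m) ℝ => (M *ᵥ fun _ => (1 : ℝ)) i :=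
      (continuous_apply i).comp (Continuous.matrix_mulVec continuous_id continuous_const)
    refine ((hc.tendsto _).comp h).congr fun n => ?_
    rw [hY.integral_cond_gridDiscount δ hi, Function.comp_apply, smul_smul, smul_smul]
    have : (((t / (n + 1) : ℝ≥0)) : ℝ) = ((n : ℝ) + 1)⁻¹ * t := by
      push_cast; rw [div_eq_inv_mul]
    rw [this]
    rfl
  exact tendsto_nhds_unique hlim1 hlim2

/-- A lower bound on the discount rates bounds the discounted survival function. -/
theorem IsMarkovChain.g_le_exp (hY : IsMarkovChain P Q Y) {δ : Fin m → ℝ} {d : ℝ}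
    (hd : ∀ j, d ≤ δ j) {i : Fin m} (hi : P (Y 0 ⁻¹' {i}) ≠ 0) {t : ℝ} (ht : 0 ≤ t) :
    g P Y δ i t ≤ Real.exp (-(d * t)) := by
  have := cond_isProbabilityMeasure hi
  rcases ht.eq_or_lt with rfl | htpos
  · simp [g]
  lift t to ℝ≥0 using ht
  have hT : 0 < t := by exact_mod_cast htpos
  have hbound : ∀ᵐ ω ∂(cond P (Y 0 ⁻¹' {i})),
      Real.exp (-∫ u in (0 : ℝ)..t, δ (Y u.toNNReal ω)) ≤ Real.exp (-(d * t)) := by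
    filter_upwards [cond_absolutelyContinuous.ae_le (hY.tendsto_gridDiscount δ hT)] with ω hω
    refine le_of_tendsto hω (Eventually.of_forall fun n => ?_)
    refine (gridDiscount_le Y hd _ _ ω).trans_eq ?_
    congr 1
    push_cast
    field_simp
  refine (integral_mono_of_nonneg (Eventually.of_forall fun _ => (Real.exp_pos _).le)
    (integrable_const _) hbound).trans_eq ?_
  simp

end MarkovChain

/-! ### Laplace transforms of nonnegative functions. -/

section Laplace

open Filter Topology

theorem norm_laplaceIntegrand {F : ℝ → ℝ} (hF : ∀ t, 0 ≤ F t) (u : ℂ) (t : ℝ) :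
    ‖laplaceIntegrand F u t‖ = F t * Real.exp (-(u.re * t)) := by
  rw [laplaceIntegrand, norm_mul, Complex.norm_real, Real.norm_of_nonneg (hF t), Complex.norm_exp]
  simp

theorem aestronglyMeasurable_laplaceIntegrand {F : ℝ → ℝ} (hFc : ContinuousOn F (Set.Ici 0))
    (u : ℂ) : AEStronglyMeasurable (laplaceIntegrand F u) (volume.restrict (Set.Ioi 0)) := by
  refine ContinuousOn.aestronglyMeasurable ?_ measurableSet_Ioi
  refine (Complex.continuous_ofReal.comp_continuousOn (hFc.mono Set.Ioi_subset_Ici_self)).mul ?_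
  fun_prop

/-- The Laplace transform of a nonnegative function is a complex moment generating function. -/
theorem laplaceTransform_eq_complexMGF {F : ℝ → ℝ} (hF : ∀ t, 0 ≤ F t)
    (hFm : AEMeasurable F (volume.restrict (Set.Ioi 0))) (u : ℂ) :
    laplaceTransform F u = complexMGF (fun t : ℝ => -t)
      ((volume.restrict (Set.Ioi 0)).withDensity fun t => ENNReal.ofReal (F t)) u := by
  rw [complexMGF, integral_withDensity_eq_integral_toReal_smul₀ hFm.ennreal_ofReal
    (Eventually.of_forall fun _ => ENNReal.ofReal_lt_top), laplaceTransform]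
  refine integral_congr_ae (Eventually.of_forall fun t => ?_)
  simp [laplaceIntegrand, ENNReal.toReal_ofReal (hF t)]

theorem LaplaceConverges.mono_re {F : ℝ → ℝ} (hF : ∀ t, 0 ≤ F t)
    (hFc : ContinuousOn F (Set.Ici 0)) {u v : ℂ} (hu : LaplaceConverges F u)
    (huv : u.re ≤ v.re) : LaplaceConverges F v := by
  refine Integrable.mono hu (aestronglyMeasurable_laplaceIntegrand hFc v) ?_
  filter_upwards [ae_restrict_mem measurableSet_Ioi] with t ht
  rw [norm_laplaceIntegrand hF, norm_laplaceIntegrand hF]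
  have : (0 : ℝ) < t := ht
  have := hF t
  gcongr

/-- A complex moment generating function is holomorphic over the interior of the set of real
exponents where it converges; taking the interior is what makes the inequality strict. -/
theorem differentiableOn_laplaceTransform {F : ℝ → ℝ} (hF : ∀ t, 0 ≤ F t)
    (hFc : ContinuousOn F (Set.Ici 0)) {u : ℂ} (hu : LaplaceConverges F u) :
    DifferentiableOn ℂ (laplaceTransform F) {z | u.re < z.re} := by
  have hFm : AEMeasurable F (volume.restrict (Set.Ioi 0)) :=
    ((hFc.mono Set.Ioi_subset_Ici_self).aestronglyMeasurable measurableSet_Ioi).aemeasurable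
  rw [funext (laplaceTransform_eq_complexMGF hF hFm)]
  refine differentiableOn_complexMGF.mono fun z hz => ?_
  refine interior_mono (s := Set.Ioi u.re) (fun x hx => ?_) (by rwa [interior_Ioi])
  have hx' : u.re ≤ (x : ℂ).re := le_of_lt hx
  have hint := (LaplaceConverges.mono_re hF hFc hu hx').norm
  rw [integrableExpSet, Set.mem_ofPred_eq, integrable_withDensity_iff_integrable_smul₀'
    hFm.ennreal_ofReal (Eventually.of_forall fun _ => ENNReal.ofReal_lt_top)]
  refine hint.congr (Eventually.of_forall fun t => ?_)
  simp [norm_laplaceIntegrand hF, ENNReal.toReal_ofReal (hF t)]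

/-- Holomorphy is known only strictly to the right of u, and u may lie on the boundary of the region
of convergence. Dominated convergence, with the integrand at u as majorant, reaches u itself. -/
theorem tendsto_laplaceTransform {F : ℝ → ℝ} (hF : ∀ t, 0 ≤ F t)
    (hFc : ContinuousOn F (Set.Ici 0)) {u : ℂ} (hu : LaplaceConverges F u) :
    Tendsto (fun ε : ℝ => laplaceTransform F (u + ε)) (𝓝[>] 0) (𝓝 (laplaceTransform F u)) := by
  refine tendsto_integral_filter_of_dominated_convergence (fun t => ‖laplaceIntegrand F u t‖)
    (Eventually.of_forall fun ε => aestronglyMeasurable_laplaceIntegrand hFc _) ?_ hu.norm ?_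
  · filter_upwards [self_mem_nhdsWithin] with ε hε
    filter_upwards [ae_restrict_mem measurableSet_Ioi] with t ht
    rw [norm_laplaceIntegrand hF, norm_laplaceIntegrand hF]
    have : (0 : ℝ) < t := ht
    have hε' : (0 : ℝ) < ε := hε
    have := hF t
    have hre : u.re ≤ (u + (ε : ℂ)).re := by simpa using hε'.le
    gcongr
  · refine Eventually.of_forall fun t => ?_
    have hc : Continuous fun ε : ℝ => laplaceIntegrand F (u + ε) t := by
      unfold laplaceIntegrand; fun_prop
    simpa using (hc.tendsto 0).mono_left nhdsWithin_le_nhds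

/-- An identity between a Laplace transform and entire functions far to the right extends to every
point of absolute convergence. -/
theorem laplaceTransform_mul_eq_of_large {F : ℝ → ℝ} (hF : ∀ t, 0 ≤ F t)
    (hFc : ContinuousOn F (Set.Ici 0)) {D N : ℂ → ℂ} (hD : Differentiable ℂ D)
    (hN : Differentiable ℂ N) {M : ℝ}
    (h : ∀ z : ℂ, M < z.re → laplaceTransform F z * D z = N z) {u : ℂ}
    (hu : LaplaceConverges F u) : laplaceTransform F u * D u = N u := by
  have hopen : ∀ a : ℝ, IsOpen {z : ℂ | a < z.re} := fun a =>
    isOpen_lt continuous_const Complex.continuous_re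
  have han1 : AnalyticOnNhd ℂ (fun z => laplaceTransform F z * D z) {z | u.re < z.re} :=
    ((differentiableOn_laplaceTransform hF hFc hu).mul hD.differentiableOn).analyticOnNhd (hopen _)
  have han2 : AnalyticOnNhd ℂ N {z | u.re < z.re} := hN.differentiableOn.analyticOnNhd (hopen _)
  -- A point inside both half-planes, near which the two analytic functions agree.
  set z₀ : ℂ := ((max u.re M + 1 : ℝ) : ℂ) with hz₀
  have hz₀re : z₀.re = max u.re M + 1 := Complex.ofReal_re _
  have heq := han1.eqOn_of_preconnected_of_eventuallyEq han2
    (convex_halfSpace_re_gt u.re).isPreconnected (z₀ := z₀)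
    (by rw [Set.mem_ofPred_eq, hz₀re]; linarith [le_max_left u.re M])
    (by
      filter_upwards [(hopen M).mem_nhds
        (show z₀ ∈ {z : ℂ | M < z.re} by
          rw [Set.mem_ofPred_eq, hz₀re]; linarith [le_max_right u.re M])] with z hz using h z hz)
  have hlin : Tendsto (fun ε : ℝ => u + (ε : ℂ)) (𝓝[>] 0) (𝓝 u) := by
    have : Continuous fun ε : ℝ => u + (ε : ℂ) := by fun_prop
    simpa using (this.tendsto 0).mono_left nhdsWithin_le_nhds
  refine tendsto_nhds_unique ((tendsto_laplaceTransform hF hFc hu).mul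
    ((hD.continuous.tendsto u).comp hlin)) (((hN.continuous.tendsto u).comp hlin).congr' ?_)
  filter_upwards [self_mem_nhdsWithin] with ε hε
  refine (heq ?_).symm
  have : (0 : ℝ) < ε := hε
  simpa using this

open Matrix in
/-- The Laplace transform of a component of `e^{tB}(u - B)w` far to the right is that of `w`. -/
theorem laplaceTransform_exp_smul_mulVec {m : ℕ} {B : Matrix (Fin m) (Fin m) ℂ} {i : Fin m}
    {K : ℝ} (hK : ∀ (w : Fin m → ℂ) (t : ℝ), 0 ≤ t →
      ‖(NormedSpace.exp ((t : ℂ) • B) *ᵥ w) i‖ ≤ ‖w‖ * Real.exp (K * t))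
    {F : ℝ → ℝ} {u : ℂ} (hu : K < u.re) {w x : Fin m → ℂ}
    (hw : (scalar (Fin m) u - B) *ᵥ w = x)
    (hF : ∀ t, 0 ≤ t → (F t : ℂ) = (NormedSpace.exp ((t : ℂ) • B) *ᵥ x) i)
    (hconv : LaplaceConverges F u) : laplaceTransform F u = w i := by
  -- An antiderivative of the integrand, because e^{tB} x = e^{tB} (u - B) w. It vanishes at
  -- infinity since K < Re u, and -H(0) = w_i.
  set H : ℝ → ℂ := fun t =>
    -(Complex.exp (-u * t) * (NormedSpace.exp ((t : ℂ) • B) *ᵥ w) i) with hH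
  have hder : ∀ t : ℝ, HasDerivAt H
      ((NormedSpace.exp ((t : ℂ) • B) *ᵥ x) i * Complex.exp (-u * t)) t := by
    intro t
    have he : HasDerivAt (fun t : ℝ => Complex.exp (-u * t)) (Complex.exp (-u * t) * (-u * 1)) t :=
      ((hasDerivAt_id (t : ℂ)).const_mul (-u)).cexp.comp_ofReal
    refine (he.mul (hasDerivAt_exp_smul_mulVec B w i t)).neg.congr_deriv ?_
    rw [← hw, sub_mulVec, scalar_apply, ← smul_one_eq_diagonal, smul_mulVec, one_mulVec,
      mulVec_sub, mulVec_smul, Pi.sub_apply, Pi.smul_apply, smul_eq_mul]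
    ring
  have hlim : Tendsto H atTop (𝓝 0) := by
    rw [tendsto_zero_iff_norm_tendsto_zero]
    have hexp : Tendsto (fun t : ℝ => ‖w‖ * Real.exp (-((u.re - K) * t))) atTop (𝓝 0) := by
      have h1 : Tendsto (fun t : ℝ => (u.re - K) * t) atTop atTop :=
        tendsto_id.const_mul_atTop (by linarith)
      simpa using (Real.tendsto_exp_neg_atTop_nhds_zero.comp h1).const_mul ‖w‖
    refine squeeze_zero' (Eventually.of_forall fun _ => norm_nonneg _) ?_ hexp
    filter_upwards [eventually_ge_atTop 0] with t ht
    rw [hH, norm_neg, norm_mul, Complex.norm_exp]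
    have h1 : Real.exp (-((u.re - K) * t)) = Real.exp ((-u * (t : ℂ)).re) * Real.exp (K * t) := by
      rw [← Real.exp_add]; congr 1; simp; ring
    rw [h1]
    calc _ ≤ Real.exp ((-u * (t : ℂ)).re) * (‖w‖ * Real.exp (K * t)) := by
            gcongr; exact hK w t ht
      _ = _ := by ring
  have hcongr : Set.EqOn (laplaceIntegrand F u)
      (fun t : ℝ => (NormedSpace.exp ((t : ℂ) • B) *ᵥ x) i * Complex.exp (-u * t)) (Set.Ioi 0) :=
    fun t ht => by rw [laplaceIntegrand, hF t (le_of_lt ht)]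
  rw [laplaceTransform, setIntegral_congr_fun measurableSet_Ioi hcongr,
    integral_Ioi_of_hasDerivAt_of_tendsto (hder 0).continuousAt.continuousWithinAt
      (fun t _ => hder t) (hconv.congr_fun hcongr measurableSet_Ioi) hlim]
  simp [hH]

end Laplace

/-! ### The system matrix and the main theorem. -/

section Assembly

open Matrix

variable {m : ℕ}

theorem systemMatrix_eq (Q : Matrix (Fin m) (Fin m) ℝ) (δ : Fin m → ℝ) (u : ℂ) :
    systemMatrix Q δ u = scalar (Fin m) u - (Q - diagonal δ).map (algebraMap ℝ ℂ) := by
  ext i j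
  by_cases h : i = j
  · subst h
    simp [systemMatrix, exitRate]
    ring
  · simp [systemMatrix, scalar_apply, h]

/-- Strict diagonal dominance: the off-diagonal moduli in row k sum to q_k, while the diagonal entry
has real part Re u + δ(k) + q_k > q_k. -/
theorem det_systemMatrix_ne_zero {Q : Matrix (Fin m) (Fin m) ℝ} (hQ : IsGenerator Q)
    {δ : Fin m → ℝ} {u : ℂ} (hu : ∀ j, -δ j < u.re) : (systemMatrix Q δ u).det ≠ 0 := by
  refine det_ne_zero_of_sum_row_lt_diag fun k => ?_
  have hoff : ∑ j ∈ Finset.univ.erase k, ‖systemMatrix Q δ u k j‖ = exitRate Q k := by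
    have h1 : ∀ j ∈ Finset.univ.erase k, ‖systemMatrix Q δ u k j‖ = Q k j := by
      intro j hj
      have hne : k ≠ j := (Finset.ne_of_mem_erase hj).symm
      simp [systemMatrix, hne, abs_of_nonneg (hQ.offDiag_nonneg k j hne)]
    rw [Finset.sum_congr rfl h1, exitRate, eq_neg_iff_add_eq_zero,
      Finset.sum_erase_add _ _ (Finset.mem_univ k), hQ.row_sum]
  rw [hoff]
  refine lt_of_lt_of_le ?_ (Complex.re_le_norm _)
  have := hu k
  simp [systemMatrix]
  linarith

end Assembly

end RegimeSwitching

theorem mainTheorem5 {Ω : Type*} [MeasurableSpace Ω] (P : Measure Ω) [IsProbabilityMeasure P]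
    {m : ℕ} (Q : Matrix (Fin m) (Fin m) ℝ) (hQ : RegimeSwitching.IsGenerator Q)
    (Y : ℝ≥0 → Ω → Fin m) (hY : RegimeSwitching.IsMarkovChain P Q Y) (δ : Fin m → ℝ) :
    ∃ D : Polynomial ℝ, D.Monic ∧ D.natDegree = m ∧
      (∀ u : ℂ, Polynomial.aeval u D = (RegimeSwitching.systemMatrix Q δ u).det) ∧
      ∀ i : Fin m, P (Y 0 ⁻¹' {i}) ≠ 0 →
        -- `g(i, ·)` is continuous and of exponential order
        ContinuousOn (RegimeSwitching.g P Y δ i) (Set.Ici 0) ∧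
        (∃ K p : ℝ, 0 < K ∧ 0 ≤ p ∧
          ∀ t : ℝ, 0 ≤ t → |RegimeSwitching.g P Y δ i t| ≤ K * Real.exp (p * t)) ∧
        -- the transform exists, and the denominator does not vanish, on a right half-plane
        (∀ u : ℂ, (∀ j, -δ j < u.re) →
          RegimeSwitching.LaplaceConverges (RegimeSwitching.g P Y δ i) u ∧
          Polynomial.aeval u D ≠ 0) ∧
        ∃ N : Polynomial ℝ, N.Monic ∧ N.natDegree = m - 1 ∧
          -- the transform is `N / D` wherever it exists
          (∀ u : ℂ, RegimeSwitching.LaplaceConverges (RegimeSwitching.g P Y δ i) u →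
            Polynomial.aeval u D ≠ 0 →
            RegimeSwitching.laplaceTransform (RegimeSwitching.g P Y δ i) u =
              Polynomial.aeval u N / Polynomial.aeval u D) ∧
          -- partial fractions of `N / D`, inverted term by term, give `g(i, ·)`
          ∃ c : ℂ → ℕ → ℂ,
            (∀ u : ℂ, Polynomial.aeval u D ≠ 0 →
              Polynomial.aeval u N / Polynomial.aeval u D =
                ∑ z ∈ (D.aroots ℂ).toFinset, ∑ k ∈ Finset.range ((D.aroots ℂ).count z),
                  c z k / (u - z) ^ (k + 1)) ∧
            ∀ t : ℝ, 0 ≤ t →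
              (RegimeSwitching.g P Y δ i t : ℂ) =
                ∑ z ∈ (D.aroots ℂ).toFinset, ∑ k ∈ Finset.range ((D.aroots ℂ).count z),
                  c z k * ((t : ℂ) ^ k / (k.factorial : ℂ)) * Complex.exp (z * (t : ℂ)) := by
  set A : Matrix (Fin m) (Fin m) ℝ := Q - Matrix.diagonal δ with hA
  set B : Matrix (Fin m) (Fin m) ℂ := A.map (algebraMap ℝ ℂ) with hB
  have hdet : ∀ u : ℂ, Polynomial.aeval u A.charpoly =
      (RegimeSwitching.systemMatrix Q δ u).det := fun u => by
    rw [RegimeSwitching.aeval_charpoly_eq_det, RegimeSwitching.systemMatrix_eq]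
  have hroots : A.charpoly.aroots ℂ = B.charpoly.roots := by
    rw [Polynomial.aroots, ← Matrix.charpoly_map]
  refine ⟨A.charpoly, Matrix.charpoly_monic A, by
    rw [Matrix.charpoly_natDegree_eq_dim, Fintype.card_fin], hdet, fun i hi => ?_⟩
  have hgexp : ∀ t : ℝ, 0 ≤ t → (RegimeSwitching.g P Y δ i t : ℂ) =
      (NormedSpace.exp ((t : ℂ) • B)).mulVec (fun _ => 1) i := by
    intro t ht
    rw [hY.g_eq_exp δ hi ht, ← RegimeSwitching.map_exp_smul]
    simp [Matrix.mulVec, dotProduct, hA]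
  have hgc : ContinuousOn (RegimeSwitching.g P Y δ i) (Set.Ici 0) := by
    have h1 : Continuous fun t : ℝ =>
        ((NormedSpace.exp ((t : ℂ) • B)).mulVec (fun _ => 1) i).re :=
      Complex.continuous_re.comp (continuous_iff_continuousAt.2 fun t =>
        (RegimeSwitching.hasDerivAt_exp_smul_mulVec B (fun _ => 1) i t).continuousAt)
    exact h1.continuousOn.congr fun t ht => by
      simp only [← hgexp t ht, Complex.ofReal_re]
  have hg0 := RegimeSwitching.g_nonneg P Y δ i
  have : Nonempty (Fin m) := ⟨i⟩
  obtain ⟨j₀, hj₀⟩ := Finite.exists_min δ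
  have hconv : ∀ u : ℂ, (∀ j, -δ j < u.re) →
      RegimeSwitching.LaplaceConverges (RegimeSwitching.g P Y δ i) u := by
    intro u hu
    refine Integrable.mono' (exp_neg_integrableOn_Ioi 0 (b := δ j₀ + u.re) (by linarith [hu j₀]))
      (RegimeSwitching.aestronglyMeasurable_laplaceIntegrand hgc u) ?_
    filter_upwards [ae_restrict_mem measurableSet_Ioi] with t ht
    rw [RegimeSwitching.norm_laplaceIntegrand hg0]
    refine (mul_le_mul_of_nonneg_right (hY.g_le_exp hj₀ hi (le_of_lt ht))
      (Real.exp_pos _).le).trans_eq ?_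
    rw [← Real.exp_add]
    congr 1
    ring
  obtain ⟨v, hvsum, hv⟩ := RegimeSwitching.exists_primary_decomposition B fun _ => 1
  -- These coefficients serve both the resolvent and the exponential.
  set c : ℂ → ℕ → ℂ := fun z k => ((B - Matrix.scalar (Fin m) z) ^ k).mulVec (v z) i with hc
  have hres : ∀ u : ℂ, Polynomial.aeval u A.charpoly ≠ 0 →
      ∃ w : Fin m → ℂ, (Matrix.scalar (Fin m) u - B).mulVec w = (fun _ => 1) ∧
        w i = ∑ z ∈ B.charpoly.roots.toFinset, ∑ k ∈ Finset.range (B.charpoly.roots.count z),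
          c z k / (u - z) ^ (k + 1) := by
    intro u hu
    have hne : ∀ z ∈ B.charpoly.roots.toFinset, u - z ≠ 0 := by
      intro z hz h
      rw [sub_eq_zero] at h
      subst h
      rw [← hroots, Multiset.mem_toFinset, Polynomial.mem_aroots] at hz
      exact hu hz.2
    refine ⟨∑ z ∈ B.charpoly.roots.toFinset, ∑ k ∈ Finset.range (B.charpoly.roots.count z),
      ((u - z) ^ (k + 1))⁻¹ • ((B - Matrix.scalar (Fin m) z) ^ k).mulVec (v z), ?_, ?_⟩
    · rw [Matrix.mulVec_sum, ← hvsum]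
      exact Finset.sum_congr rfl fun z hz =>
        RegimeSwitching.resolvent_mulVec_generalized B (hne z hz) (hv z hz)
    · simp only [Finset.sum_apply, Pi.smul_apply, smul_eq_mul, hc, div_eq_inv_mul]
  refine ⟨hgc, ⟨1, |δ j₀|, one_pos, abs_nonneg _, fun t ht => ?_⟩, fun u hu => ⟨hconv u hu, by
    rw [hdet]; exact RegimeSwitching.det_systemMatrix_ne_zero hQ hu⟩,
    RegimeSwitching.adjugateRowSum A i, RegimeSwitching.monic_adjugateRowSum A i,
    RegimeSwitching.natDegree_adjugateRowSum A i, fun u hu hDu => ?_, c, fun u hDu => ?_,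
    fun t ht => ?_⟩
  · rw [abs_of_nonneg (hg0 t), one_mul]
    refine (hY.g_le_exp hj₀ hi ht).trans (Real.exp_le_exp.2 ?_)
    rw [← neg_mul]
    exact mul_le_mul_of_nonneg_right (neg_le_abs _) ht
  -- Clearing the denominator leaves entire functions to compare, so zeros of D to the right of u do
  -- no harm.
  · rw [eq_div_iff hDu]
    obtain ⟨K, hK⟩ := RegimeSwitching.exists_norm_exp_smul_mulVec_le B i
    refine RegimeSwitching.laplaceTransform_mul_eq_of_large hg0 hgc
      (D := fun z => Polynomial.aeval z A.charpoly)
      (N := fun z => Polynomial.aeval z (RegimeSwitching.adjugateRowSum A i))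
      (Polynomial.differentiable_aeval _) (Polynomial.differentiable_aeval _)
      -- Beyond K the boundary term at infinity vanishes; beyond -min δ the integral converges and D
      -- has no zero.
      (M := max K (-δ j₀)) (fun z hz => ?_) hu
    have hzδ : ∀ j, -δ j < z.re := fun j =>
      (neg_le_neg (hj₀ j)).trans_lt ((le_max_right _ _).trans_lt hz)
    have hDz : Polynomial.aeval z A.charpoly ≠ 0 := by
      rw [hdet]; exact RegimeSwitching.det_systemMatrix_ne_zero hQ hzδ
    obtain ⟨w, hw, -⟩ := hres z hDz
    rw [RegimeSwitching.laplaceTransform_exp_smul_mulVec hK ((le_max_left _ _).trans_lt hz) hw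
      hgexp (hconv z hzδ), RegimeSwitching.resolvent_eq_div A hDz hw, div_mul_cancel₀ _ hDz]
  · obtain ⟨w, hw, hwi⟩ := hres u hDu
    rw [← RegimeSwitching.resolvent_eq_div A hDu hw, hwi, hroots]
  · have hsum : (NormedSpace.exp ((t : ℂ) • B)).mulVec (fun _ => 1) i =
        ∑ z ∈ B.charpoly.roots.toFinset,
          (NormedSpace.exp ((t : ℂ) • B)).mulVec (v z) i := by
      rw [← hvsum, Matrix.mulVec_sum, Finset.sum_apply]
    rw [hgexp t ht, hsum, hroots]
    refine Finset.sum_congr rfl fun z hz => ?_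
    have hz' : z ∈ B.charpoly.roots.toFinset := by simpa using hz
    rw [RegimeSwitching.exp_smul_mulVec_generalized B t (hv z hz'), Finset.sum_apply]
    refine Finset.sum_congr rfl fun k _ => ?_
    rw [Pi.smul_apply, smul_eq_mul]
    ring
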